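/- Let $(\Sigma,g)$ be an oriented Riemannian surface with Levi-Civita connection $\nabla$, let $J$ be the rotation of $T\Sigma$ by the angle $\pi/2$, and for $\theta\in\mathbb R$ put $R_\theta=\cos\theta\,I+\sin\theta\,J$. Let $E\to\Sigma$ be a vector bundle of rank $d$ with a metric $\bar g$ and a compatible connection $\bar\nabla$. Let $n_1,\dots,n_m\in\mathbb N$ and $c_1,\dots,c_m\in\mathbb R$ (the dimensions and sectional curvatures of the factors of a product $\widetilde P=M_1\times\cdots\times M_m$ of simply connected real space forms). Let $B:T\Sigma\times T\Sigma\to E$, $f_i:T\Sigma\to T\Sigma$, $h_i:T\Sigma\to E$ and $t_i:E\to E$ ($1\le i\le m$) be smooth tensor fields. Define $s_i:E\to T\Sigma$ and, for $\xi\in E$, $A_\xi:T\Sigma\to T\Sigma$ by $\langle h_iX,\xi\rangle=\langle X,s_i\xi\rangle$ and $\langle A_\xi X,Y\rangle=\langle B(X,Y),\xi\rangle$. The data $(\Sigma,g,E,\bar g,\bar\nabla,B,f_i,h_i,t_i)$ are said to satisfy the compatibility equations for $\widetilde P$ if $B$ is symmetric and, for all $i,j$, all smooth vector fields $X,Y,Z$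 and all smooth sections $\xi$ of $E$: 1. $f_i$ and $t_i$ are symmetric; 2. $\sum_i f_i=\mathrm{Id}$, $\sum_i t_i=\mathrm{Id}$, $\sum_i s_i=0$, $\sum_i h_i=0$; 3. $f_if_j+s_ih_j=\delta_{ij}f_i$, $t_it_j+h_is_j=\delta_{ij}t_i$, $f_is_j+s_it_j=\delta_{ij}s_i$, $h_if_j+t_ih_j=\delta_{ij}h_i$; 4. $\nabla_X(f_iY)-f_i\nabla_XY=A_{h_iY}X+s_iB(X,Y)$, $\ \bar\nabla_X(h_iY)-h_i\nabla_XY=t_iB(X,Y)-B(X,f_iY)$, $\ \bar\nabla_X(t_i\xi)-t_i\bar\nabla_X\xi=-B(s_i\xi,X)-h_iA_\xi X$; 5. the operator $\pi_i(X,\xi)=(f_iX+s_i\xi,\;h_iX+t_i\xi)$ of $T\Sigma\oplus E$ has rank $n_i$ at every point, and $\sum_i n_i=2+d$; 6. (Gauss) $R(X,Y)Z=\sum_i c_i\big[\langle f_iY,Z\rangle f_iX-\langle f_iX,Z\rangle f_iY\big]+A_{B(Y,Z)}X-A_{B(X,Z)}Y$; 7. (Codazzi) $(\nabla_XB)(Y,Z)-(\nabla_YB)(X,Z)=\sum_i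 c_i\big[\langle f_iY,Z\rangle h_iX-\langle f_iX,Z\rangle h_iY\big]$; 8. (Ricci) $\bar R(X,Y)\xi=\sum_i c_i\big[\langle h_iY,\xi\rangle h_iX-\langle h_iX,\xi\rangle h_iY\big]+B(A_\xi Y,X)-B(A_\xi X,Y)$. Here $R$ and $\bar R$ are the curvatures of $\nabla$ and $\bar\nabla$, with $R(X,Y)=\nabla_X\nabla_Y-\nabla_Y\nabla_X-\nabla_{[X,Y]}$, and $(\nabla_XB)(Y,Z)=\bar\nabla_X(B(Y,Z))-B(\nabla_XY,Z)-B(Y,\nabla_XZ)$. **Proposition.** Suppose that $(\Sigma,g,E,\bar g,\bar\nabla,B,f_i,h_i,t_i)$ satisfies the compatibility equations for $\widetilde P$ and that $B$ is trace-free, i.e. $\operatorname{tr}A_\xi=0$ for every $\xi\in E$. Then for every $\theta\in\mathbb R$ the rotated data $(\Sigma,g,E,\bar g,\bar\nabla,B_\theta,f_{i,\theta},h_{i,\theta},t_{i,\theta})$ given by $$B_\theta(X,Y)=B(R_\theta^{-1}X,Y),\quad f_{i,\theta}=R_\theta f_iR_\theta^{-1},\quad h_{i,\theta}=h_iR_\theta^{-1},\quad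 t_{i,\theta}=t_i$$ also satisfy the compatibility equations for $\widetilde P$ (with the same $n_i$ and $c_i$; in particular $B_\theta$ is symmetric and all the rotated tensor fields are smooth), and $B_\theta$ is again trace-free. -/

import Mathlib

open Bundle
open scoped Manifold ContDiff Topology

noncomputable section

namespace Multiproduct

section Fibre

variable {W U : Type*} [NormedAddCommGroup W] [InnerProductSpace ℝ W] [CompleteSpace W]
  [NormedAddCommGroup U] [InnerProductSpace ℝ U] [CompleteSpace U]

/-- For a bilinear map `b : W × W → U` and `ξ : U`, the operator `A` of `W` such that
`⟨A X, Y⟩ = ⟨b(X, Y), ξ⟩` for all `X`, `Y`. -/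
def shapeOperator (b : W →L[ℝ] W →L[ℝ] U) (ξ : U) : W →ₗ[ℝ] W where
  toFun X := ContinuousLinearMap.adjoint (b X) ξ
  map_add' X Y := by simp
  map_smul' a X := by simp

theorem inner_shapeOperator (b : W →L[ℝ] W →L[ℝ] U) (ξ : U) (X Y : W) :
    inner ℝ (shapeOperator b ξ X) Y = inner ℝ (b X Y) ξ := by
  change inner ℝ (ContinuousLinearMap.adjoint (b X) ξ) Y = _
  rw [ContinuousLinearMap.adjoint_inner_left, real_inner_comm]

end Fibre

section General

variable {E : Type*} [NormedAddCommGroup E] [NormedSpace ℝ E] [FiniteDimensional ℝ E]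
  {H : Type*} [TopologicalSpace H] (I : ModelWithCorners ℝ E H)
  {M : Type*} [TopologicalSpace M] [ChartedSpace H M] [IsManifold I ∞ M]
  [RiemannianBundle (fun x : M ↦ TangentSpace I x)]
  [IsContMDiffRiemannianBundle I ∞ E (fun x : M ↦ TangentSpace I x)]
  (F : Type*) [NormedAddCommGroup F] [NormedSpace ℝ F] [FiniteDimensional ℝ F]
  (V : M → Type*) [TopologicalSpace (TotalSpace F V)]
  [∀ x, NormedAddCommGroup (V x)] [∀ x, InnerProductSpace ℝ (V x)]
  [FiberBundle F V] [VectorBundle ℝ F V] [ContMDiffVectorBundle ∞ F V I]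

/-- Smooth global vector fields on `M`. -/
def IsSmoothField (X : Π x : M, TangentSpace I x) : Prop :=
  ContMDiff I (I.prod 𝓘(ℝ, E)) ∞ (fun x ↦ (⟨x, X x⟩ : TotalSpace E (TangentSpace I : M → Type _)))

variable {V} in
/-- Smooth global sections of the bundle `V` over `M`. -/
def IsSmoothSection (ξ : Π x : M, V x) : Prop :=
  ContMDiff I (I.prod 𝓘(ℝ, F)) ∞ (fun x ↦ (⟨x, ξ x⟩ : TotalSpace F V))

/-- The tensor fields `B : TM × TM → V`, `f i : TM → TM`, `h i : TM → V`, `t i : V → V`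
(`i = 1, …, m`), as families of (multi)linear maps between the fibres. -/
structure TensorData (m : ℕ) where
  B : Π x : M, TangentSpace I x →L[ℝ] TangentSpace I x →L[ℝ] V x
  f : Fin m → Π x : M, TangentSpace I x →L[ℝ] TangentSpace I x
  h : Fin m → Π x : M, TangentSpace I x →L[ℝ] V x
  t : Fin m → Π x : M, V x →L[ℝ] V x

namespace TensorData

variable {I} {V} {m : ℕ} (D : TensorData I V m)

/-- All the tensor fields are smooth, as sections of the corresponding bundles of homomorphisms. -/
structure IsSmooth : Prop where
  B : ContMDiff I (I.prod 𝓘(ℝ, E →L[ℝ] E →L[ℝ] F)) ∞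
    (fun x ↦ TotalSpace.mk' (E →L[ℝ] E →L[ℝ] F)
      (E := fun x : M ↦ TangentSpace I x →L[ℝ] TangentSpace I x →L[ℝ] V x) x (D.B x))
  f : ∀ i, ContMDiff I (I.prod 𝓘(ℝ, E →L[ℝ] E)) ∞
    (fun x ↦ TotalSpace.mk' (E →L[ℝ] E)
      (E := fun x : M ↦ TangentSpace I x →L[ℝ] TangentSpace I x) x (D.f i x))
  h : ∀ i, ContMDiff I (I.prod 𝓘(ℝ, E →L[ℝ] F)) ∞
    (fun x ↦ TotalSpace.mk' (E →L[ℝ] F)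
      (E := fun x : M ↦ TangentSpace I x →L[ℝ] V x) x (D.h i x))
  t : ∀ i, ContMDiff I (I.prod 𝓘(ℝ, F →L[ℝ] F)) ∞
    (fun x ↦ TotalSpace.mk' (F →L[ℝ] F)
      (E := fun x : M ↦ V x →L[ℝ] V x) x (D.t i x))

/-- `s i : V → TM`, the dual of `h i`: `⟨h i X, ξ⟩ = ⟨X, s i ξ⟩`. -/
def s (i : Fin m) (x : M) : V x →L[ℝ] TangentSpace I x :=
  haveI : FiniteDimensional ℝ (TangentSpace I x) :=
    VectorBundle.finiteDimensional ℝ E (TangentSpace I : M → Type _) x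
  haveI : FiniteDimensional ℝ (V x) := VectorBundle.finiteDimensional ℝ F V x
  haveI : CompleteSpace (TangentSpace I x) := FiniteDimensional.complete ℝ _
  haveI : CompleteSpace (V x) := FiniteDimensional.complete ℝ _
  ContinuousLinearMap.adjoint (D.h i x)

/-- The Weingarten operator `A_ξ`: `⟨A_ξ X, Y⟩ = ⟨B(X, Y), ξ⟩`. -/
def A (x : M) (ξ : V x) : TangentSpace I x →ₗ[ℝ] TangentSpace I x :=
  haveI : FiniteDimensional ℝ (TangentSpace I x) :=
    VectorBundle.finiteDimensional ℝ E (TangentSpace I : M → Type _) x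
  haveI : FiniteDimensional ℝ (V x) := VectorBundle.finiteDimensional ℝ F V x
  haveI : CompleteSpace (TangentSpace I x) := FiniteDimensional.complete ℝ _
  haveI : CompleteSpace (V x) := FiniteDimensional.complete ℝ _
  shapeOperator (D.B x) ξ

/-- The operator `π i` of `TM ⊕ V` with blocks `f i`, `s i`, `h i`, `t i`:
`π i (X, ξ) = (f i X + s i ξ, h i X + t i ξ)`. -/
def proj (i : Fin m) (x : M) : (TangentSpace I x × V x) →ₗ[ℝ] (TangentSpace I x × V x) :=
  LinearMap.prod
    (LinearMap.coprod (D.f i x : TangentSpace I x →ₗ[ℝ] TangentSpace I x)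
      (D.s F i x : V x →ₗ[ℝ] TangentSpace I x))
    (LinearMap.coprod (D.h i x : TangentSpace I x →ₗ[ℝ] V x) (D.t i x : V x →ₗ[ℝ] V x))

/-- `B` is trace-free: `tr A_ξ = 0` for every `ξ`. -/
def IsTraceFree : Prop :=
  ∀ (x : M) (ξ : V x), LinearMap.trace ℝ (TangentSpace I x) (D.A F x ξ) = 0

end TensorData

variable {I} {F} {V}

/-- The curvature `R(X,Y)σ = ∇_X ∇_Y σ - ∇_Y ∇_X σ - ∇_{[X,Y]} σ` of a connection
(`cov σ x v` is `∇_v σ` at `x`). -/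
def curvature {F' : Type*} [NormedAddCommGroup F'] [NormedSpace ℝ F']
    {W : M → Type*} [TopologicalSpace (TotalSpace F' W)]
    [∀ x, AddCommGroup (W x)] [∀ x, Module ℝ (W x)] [∀ x, TopologicalSpace (W x)]
    [∀ x, IsTopologicalAddGroup (W x)] [∀ x, ContinuousSMul ℝ (W x)] [FiberBundle F' W]
    (cov : CovariantDerivative I F' W) (X Y : Π x : M, TangentSpace I x) (σ : Π x : M, W x)
    (x : M) : W x :=
  cov (fun y ↦ cov σ y (Y y)) x (X x) - cov (fun y ↦ cov σ y (X y)) x (Y x)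
    - cov σ x (VectorField.mlieBracket I X Y x)

/-- `∇` is the Levi-Civita connection of the Riemannian metric of `M`. -/
structure IsLeviCivita (nabla : CovariantDerivative I E (TangentSpace I : M → Type _)) : Prop where
  metric : CovariantDerivative.IsMetricCompatible (F := E) (V := fun x : M ↦ TangentSpace I x)
    (cov := nabla)
  torsion : nabla.torsion = 0

/-- `(∇_X B)(Y, Z) = ∇̄_X (B(Y, Z)) - B(∇_X Y, Z) - B(Y, ∇_X Z)`. -/
def covDerivB (nabla : CovariantDerivative I E (TangentSpace I : M → Type _))
    (nablaBar : CovariantDerivative I F V)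
    (B : Π x : M, TangentSpace I x →L[ℝ] TangentSpace I x →L[ℝ] V x)
    (X Y Z : Π x : M, TangentSpace I x) (x : M) : V x :=
  nablaBar (fun y ↦ B y (Y y) (Z y)) x (X x) - B x (nabla Y x (X x)) (Z x)
    - B x (Y x) (nabla Z x (X x))

/-- The tensor fields `B` (symmetric), `f i`, `h i`, `t i` on the Riemannian manifold `M` with
Levi-Civita connection `nabla` and on the bundle `V` over `M` with metric and connection `nablaBar`
satisfy the compatibility equations for the product of `m` simply connected real space forms of
dimensions `n i` and sectional curvatures `c i`. -/
structure Compatible (nabla : CovariantDerivative I E (TangentSpace I : M → Type _))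
    (nablaBar : CovariantDerivative I F V) {m : ℕ} (n : Fin m → ℕ) (c : Fin m → ℝ)
    (D : TensorData I V m) : Prop where
  smooth : D.IsSmooth F
  symm_B : ∀ (x : M) (X Y : TangentSpace I x), D.B x X Y = D.B x Y X
  symm_f : ∀ (i : Fin m) (x : M) (X Y : TangentSpace I x),
    inner ℝ (D.f i x X) Y = inner ℝ X (D.f i x Y)
  symm_t : ∀ (i : Fin m) (x : M) (ξ η : V x), inner ℝ (D.t i x ξ) η = inner ℝ ξ (D.t i x η)
  sum_f : ∀ (x : M) (X : TangentSpace I x), ∑ i, D.f i x X = X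
  sum_t : ∀ (x : M) (ξ : V x), ∑ i, D.t i x ξ = ξ
  sum_s : ∀ (x : M) (ξ : V x), ∑ i, D.s F i x ξ = 0
  sum_h : ∀ (x : M) (X : TangentSpace I x), ∑ i, D.h i x X = 0
  ff_sh : ∀ (i j : Fin m) (x : M) (X : TangentSpace I x),
    D.f i x (D.f j x X) + D.s F i x (D.h j x X) = if i = j then D.f i x X else 0
  tt_hs : ∀ (i j : Fin m) (x : M) (ξ : V x),
    D.t i x (D.t j x ξ) + D.h i x (D.s F j x ξ) = if i = j then D.t i x ξ else 0
  fs_st : ∀ (i j : Fin m) (x : M) (ξ : V x),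
    D.f i x (D.s F j x ξ) + D.s F i x (D.t j x ξ) = if i = j then D.s F i x ξ else 0
  hf_th : ∀ (i j : Fin m) (x : M) (X : TangentSpace I x),
    D.h i x (D.f j x X) + D.t i x (D.h j x X) = if i = j then D.h i x X else 0
  deriv_f : ∀ (i : Fin m) (X Y : Π x : M, TangentSpace I x),
    IsSmoothField I X → IsSmoothField I Y → ∀ x,
    nabla (fun y ↦ D.f i y (Y y)) x (X x) - D.f i x (nabla Y x (X x))
      = D.A F x (D.h i x (Y x)) (X x) + D.s F i x (D.B x (X x) (Y x))
  deriv_h : ∀ (i : Fin m) (X Y : Π x : M, TangentSpace I x),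
    IsSmoothField I X → IsSmoothField I Y → ∀ x,
    nablaBar (fun y ↦ D.h i y (Y y)) x (X x) - D.h i x (nabla Y x (X x))
      = D.t i x (D.B x (X x) (Y x)) - D.B x (X x) (D.f i x (Y x))
  deriv_t : ∀ (i : Fin m) (X : Π x : M, TangentSpace I x) (ξ : Π x : M, V x),
    IsSmoothField I X → IsSmoothSection I F ξ → ∀ x,
    nablaBar (fun y ↦ D.t i y (ξ y)) x (X x) - D.t i x (nablaBar ξ x (X x))
      = - D.B x (D.s F i x (ξ x)) (X x) - D.h i x (D.A F x (ξ x) (X x))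
  rank_proj : ∀ (i : Fin m) (x : M), Module.finrank ℝ (LinearMap.range (D.proj F i x)) = n i
  sum_dim : ∑ i, n i = Module.finrank ℝ E + Module.finrank ℝ F
  gauss : ∀ X Y Z : Π x : M, TangentSpace I x,
    IsSmoothField I X → IsSmoothField I Y → IsSmoothField I Z → ∀ x,
    curvature nabla X Y Z x
      = ∑ i, c i • (inner ℝ (D.f i x (Y x)) (Z x) • D.f i x (X x)
          - inner ℝ (D.f i x (X x)) (Z x) • D.f i x (Y x))
        + D.A F x (D.B x (Y x) (Z x)) (X x) - D.A F x (D.B x (X x) (Z x)) (Y x)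
  codazzi : ∀ X Y Z : Π x : M, TangentSpace I x,
    IsSmoothField I X → IsSmoothField I Y → IsSmoothField I Z → ∀ x,
    covDerivB nabla nablaBar D.B X Y Z x - covDerivB nabla nablaBar D.B Y X Z x
      = ∑ i, c i • (inner ℝ (D.f i x (Y x)) (Z x) • D.h i x (X x)
          - inner ℝ (D.f i x (X x)) (Z x) • D.h i x (Y x))
  ricci : ∀ (X Y : Π x : M, TangentSpace I x) (ξ : Π x : M, V x),
    IsSmoothField I X → IsSmoothField I Y → IsSmoothSection I F ξ → ∀ x,
    curvature nablaBar X Y ξ x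
      = ∑ i, c i • (inner ℝ (D.h i x (Y x)) (ξ x) • D.h i x (X x)
          - inner ℝ (D.h i x (X x)) (ξ x) • D.h i x (Y x))
        + D.B x (D.A F x (ξ x) (Y x)) (X x) - D.B x (D.A F x (ξ x) (X x)) (Y x)

end General

section Surface

variable {S : Type*} [TopologicalSpace S] [ChartedSpace (EuclideanSpace ℝ (Fin 2)) S]
  [IsManifold (𝓡 2) ∞ S]

instance (x : S) : Fact (Module.finrank ℝ (TangentSpace (𝓡 2) x) = 2) :=
  ⟨finrank_euclideanSpace_fin (𝕜 := ℝ) (n := 2)⟩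

variable [RiemannianBundle (fun x : S ↦ TangentSpace (𝓡 2) x)]
  [IsContMDiffRiemannianBundle (𝓡 2) ∞ (EuclideanSpace ℝ (Fin 2))
    (fun x : S ↦ TangentSpace (𝓡 2) x)]

/-- A family of orientations of the tangent planes of a Riemannian surface is an orientation of the
surface if near every point there is a smooth positively oriented frame. -/
def IsOrientation (o : Π x : S, Orientation ℝ (TangentSpace (𝓡 2) x) (Fin 2)) : Prop :=
  ∀ x : S, ∃ X Y : Π y : S, TangentSpace (𝓡 2) y,
    ContMDiffAt (𝓡 2) ((𝓡 2).prod 𝓘(ℝ, EuclideanSpace ℝ (Fin 2))) ∞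
      (fun y ↦ (⟨y, X y⟩ : TotalSpace (EuclideanSpace ℝ (Fin 2))
        (TangentSpace (𝓡 2) : S → Type _))) x ∧
    ContMDiffAt (𝓡 2) ((𝓡 2).prod 𝓘(ℝ, EuclideanSpace ℝ (Fin 2))) ∞
      (fun y ↦ (⟨y, Y y⟩ : TotalSpace (EuclideanSpace ℝ (Fin 2))
        (TangentSpace (𝓡 2) : S → Type _))) x ∧
    ∀ᶠ y in 𝓝 x, 0 < (o y).areaForm (X y) (Y y)

/-- `R_θ = cos θ I + sin θ J`, where `J` is the rotation by the angle `π/2`. -/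
def rot (o : Π x : S, Orientation ℝ (TangentSpace (𝓡 2) x) (Fin 2)) (θ : ℝ) (x : S) :
    TangentSpace (𝓡 2) x →L[ℝ] TangentSpace (𝓡 2) x :=
  Real.cos θ • ContinuousLinearMap.id ℝ (TangentSpace (𝓡 2) x)
    + Real.sin θ • ((o x).rightAngleRotation : TangentSpace (𝓡 2) x →L[ℝ] TangentSpace (𝓡 2) x)

variable {V : S → Type*} [∀ x, NormedAddCommGroup (V x)] [∀ x, InnerProductSpace ℝ (V x)]

/-- The rotated tensor fields `B_θ(X, Y) = B(R_θ⁻¹ X, Y)`, `f_{i,θ} = R_θ ∘ f_i ∘ R_θ⁻¹`,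
`h_{i,θ} = h_i ∘ R_θ⁻¹`, `t_{i,θ} = t_i`. -/
def TensorData.rotate {m : ℕ} (o : Π x : S, Orientation ℝ (TangentSpace (𝓡 2) x) (Fin 2))
    (θ : ℝ) (D : TensorData (𝓡 2) V m) : TensorData (𝓡 2) V m where
  B x := (D.B x).comp (rot o θ x).inverse
  f i x := (rot o θ x).comp ((D.f i x).comp (rot o θ x).inverse)
  h i x := (D.h i x).comp (rot o θ x).inverse
  t i x := D.t i x

end Surface

end Multiproduct

end

noncomputable section

namespace Multiproduct

section Plane

variable {W : Type*} [NormedAddCommGroup W] [InnerProductSpace ℝ W]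
  [Fact (Module.finrank ℝ W = 2)] (o : Orientation ℝ W (Fin 2))

theorem exists_eq_smul_add_smul_rightAngleRotation {X : W} (hX : X ≠ 0) (Y : W) :
    ∃ a b : ℝ, Y = a • X + b • o.rightAngleRotation X := by
  refine ⟨(o.basisRightAngleRotation X hX).repr Y 0, (o.basisRightAngleRotation X hX).repr Y 1, ?_⟩
  have := (o.basisRightAngleRotation X hX).sum_repr Y
  simpa [Fin.sum_univ_two] using this.symm

theorem eq_of_inner_rightAngleRotation {X u v : W} (hX : X ≠ 0)
    (h₁ : inner ℝ u X = inner ℝ v X)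
    (h₂ : inner ℝ u (o.rightAngleRotation X) = inner ℝ v (o.rightAngleRotation X)) : u = v := by
  refine ext_inner_right ℝ fun Y ↦ ?_
  obtain ⟨a, b, rfl⟩ := exists_eq_smul_add_smul_rightAngleRotation o hX Y
  simp only [inner_add_right, inner_smul_right, h₁, h₂]

/-- In terms of a positive frame `X`, `Y`: `ω(X, Y) J Z = ⟨X, Z⟩ Y - ⟨Y, Z⟩ X`. -/
theorem areaForm_smul_rightAngleRotation (X Y Z : W) :
    o.areaForm X Y • o.rightAngleRotation Z = (inner ℝ X Z : ℝ) • Y - (inner ℝ Y Z : ℝ) • X := by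
  by_cases hX : X = 0
  · simp [hX]
  obtain ⟨a, b, rfl⟩ := exists_eq_smul_add_smul_rightAngleRotation o hX Y
  obtain ⟨c, d, rfl⟩ := exists_eq_smul_add_smul_rightAngleRotation o hX Z
  simp [inner_add_left, inner_add_right, inner_smul_left, inner_smul_right, smul_smul]
  module

theorem areaForm_sq (X Y : W) :
    o.areaForm X Y ^ 2 = inner ℝ X X * inner ℝ Y Y - (inner ℝ X Y : ℝ) ^ 2 := by
  have := o.inner_sq_add_areaForm_sq X Y
  simp only [real_inner_self_eq_norm_sq]
  linarith

section Antisymmetrization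

variable {G : Type*} [AddCommGroup G] [Module ℝ G] (b : W →ₗ[ℝ] W →ₗ[ℝ] G)

/-- The antisymmetrization of a bilinear map on a plane is invariant under rotations. -/
theorem antisymm_comp_rotation (θ : ℝ) {Q : W → W}
    (hQ : ∀ X, Q X = Real.cos θ • X + Real.sin θ • o.rightAngleRotation X) (X Y : W) :
    b (Q X) (Q Y) - b (Q Y) (Q X) = b X Y - b Y X := by
  by_cases hX : X = 0
  · simp [hX, hQ]
  obtain ⟨c, d, rfl⟩ := exists_eq_smul_add_smul_rightAngleRotation o hX Y
  have h := Real.cos_sq_add_sin_sq θ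
  simp only [hQ, map_add, map_smul, LinearMap.add_apply, LinearMap.smul_apply,
    o.rightAngleRotation_rightAngleRotation, map_neg, LinearMap.neg_apply]
  generalize b X (o.rightAngleRotation X) = u
  generalize b (o.rightAngleRotation X) X = v
  generalize b X X = p
  generalize b (o.rightAngleRotation X) (o.rightAngleRotation X) = q
  calc _ = (Real.cos θ ^ 2 + Real.sin θ ^ 2) • (d • (u - v)) := by module
    _ = _ := by rw [h]; module

end Antisymmetrization

theorem trace_eq_inner_rightAngleRotation (T : W →ₗ[ℝ] W) {X : W} (hX : ‖X‖ = 1) :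
    LinearMap.trace ℝ W T
      = inner ℝ X (T X) + inner ℝ (o.rightAngleRotation X) (T (o.rightAngleRotation X)) := by
  have hon : Orthonormal ℝ ![X, o.rightAngleRotation X] := by
    rw [orthonormal_vecCons_iff]
    simp [hX]
  have hX0 : X ≠ 0 := by rintro rfl; simp at hX
  let e := (o.basisRightAngleRotation X hX0).toOrthonormalBasis (by simpa using hon)
  rw [T.trace_eq_sum_inner e]
  simp [e, Fin.sum_univ_two]

/-- A trace-free symmetric operator of a plane anticommutes with the rotation by `π/2`. -/
theorem map_rightAngleRotation_of_trace_eq_zero (T : W →ₗ[ℝ] W)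
    (hT : ∀ X Y, inner ℝ (T X) Y = (inner ℝ X (T Y) : ℝ)) (h0 : LinearMap.trace ℝ W T = 0) (X : W) :
    T (o.rightAngleRotation X) = - o.rightAngleRotation (T X) := by
  by_cases hX : X = 0
  · simp [hX]
  have key : inner ℝ X (T X) + inner ℝ (o.rightAngleRotation X) (T (o.rightAngleRotation X))
      = (0 : ℝ) := by
    have hn : ‖X‖ ≠ 0 := by simpa using hX
    have h1 : ‖‖X‖⁻¹ • X‖ = 1 := by simp [norm_smul, hn]
    have := trace_eq_inner_rightAngleRotation o T h1
    rw [h0] at this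
    simp only [map_smul, inner_smul_left, inner_smul_right] at this
    simp only [conj_trivial, ← mul_add] at this
    simpa [hX] using this.symm
  apply eq_of_inner_rightAngleRotation o hX
  · rw [hT, inner_neg_left, ← o.inner_rightAngleRotation_swap, real_inner_comm]
  · rw [inner_neg_left, o.inner_comp_rightAngleRotation, real_inner_comm, real_inner_comm X]
    linarith

end Plane

section Hom

variable {B F₁ F₂ F₃ : Type*} {n : WithTop ℕ∞}
  {E₁ : B → Type*} [∀ x, AddCommGroup (E₁ x)] [∀ x, Module ℝ (E₁ x)] [NormedAddCommGroup F₁]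
  [NormedSpace ℝ F₁] [TopologicalSpace (TotalSpace F₁ E₁)] [∀ x, TopologicalSpace (E₁ x)]
  {E₂ : B → Type*} [∀ x, AddCommGroup (E₂ x)] [∀ x, Module ℝ (E₂ x)] [NormedAddCommGroup F₂]
  [NormedSpace ℝ F₂] [TopologicalSpace (TotalSpace F₂ E₂)] [∀ x, TopologicalSpace (E₂ x)]
  {E₃ : B → Type*} [∀ x, AddCommGroup (E₃ x)] [∀ x, Module ℝ (E₃ x)] [NormedAddCommGroup F₃]
  [NormedSpace ℝ F₃] [TopologicalSpace (TotalSpace F₃ E₃)] [∀ x, TopologicalSpace (E₃ x)]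
  {EB : Type*} [NormedAddCommGroup EB] [NormedSpace ℝ EB] {HB : Type*} [TopologicalSpace HB]
  {IB : ModelWithCorners ℝ EB HB} [TopologicalSpace B] [ChartedSpace HB B]
  [FiberBundle F₁ E₁] [VectorBundle ℝ F₁ E₁]
  [FiberBundle F₂ E₂] [VectorBundle ℝ F₂ E₂]
  [FiberBundle F₃ E₃] [VectorBundle ℝ F₃ E₃]
  [∀ x, IsTopologicalAddGroup (E₂ x)] [∀ x, ContinuousSMul ℝ (E₂ x)]

/-- The composition of smooth sections of bundles of homomorphisms is smooth. -/
theorem contMDiffAt_clm_bundle_comp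
    [∀ x, IsTopologicalAddGroup (E₃ x)] [∀ x, ContinuousSMul ℝ (E₃ x)]
    {ψ : ∀ x, E₂ x →L[ℝ] E₃ x} {φ : ∀ x, E₁ x →L[ℝ] E₂ x} {x₀ : B}
    (hψ : ContMDiffAt IB (IB.prod 𝓘(ℝ, F₂ →L[ℝ] F₃)) n
      (fun x ↦ TotalSpace.mk' (F₂ →L[ℝ] F₃) (E := fun x : B ↦ E₂ x →L[ℝ] E₃ x) x (ψ x)) x₀)
    (hφ : ContMDiffAt IB (IB.prod 𝓘(ℝ, F₁ →L[ℝ] F₂)) n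
      (fun x ↦ TotalSpace.mk' (F₁ →L[ℝ] F₂) (E := fun x : B ↦ E₁ x →L[ℝ] E₂ x) x (φ x)) x₀) :
    ContMDiffAt IB (IB.prod 𝓘(ℝ, F₁ →L[ℝ] F₃)) n
      (fun x ↦ TotalSpace.mk' (F₁ →L[ℝ] F₃) (E := fun x : B ↦ E₁ x →L[ℝ] E₃ x) x
        ((ψ x).comp (φ x))) x₀ := by
  rw [contMDiffAt_hom_bundle] at hψ hφ ⊢
  refine ⟨contMDiffAt_id, (hψ.2.clm_comp hφ.2).congr_of_eventuallyEq ?_⟩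
  filter_upwards [(trivializationAt F₂ E₂ x₀).open_baseSet.mem_nhds
    (FiberBundle.mem_baseSet_trivializationAt' x₀)] with y hy
  ext v
  simp only [ContinuousLinearMap.inCoordinates, ContinuousLinearMap.comp_apply,
    Trivialization.symmL_continuousLinearMapAt _ hy]

/-- For smooth sections `α` of the dual of `E₁` and `v` of `E₂`, the section `α ⊗ v` is smooth. -/
theorem contMDiffAt_smulRight
    {α : ∀ x, E₁ x →L[ℝ] ℝ} {v : ∀ x, E₂ x} {x₀ : B}
    (hα : ContMDiffAt IB (IB.prod 𝓘(ℝ, F₁ →L[ℝ] ℝ)) n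
      (fun x ↦ TotalSpace.mk' (F₁ →L[ℝ] ℝ)
        (E := fun x : B ↦ E₁ x →L[ℝ] Bundle.Trivial B ℝ x) x (α x)) x₀)
    (hv : ContMDiffAt IB (IB.prod 𝓘(ℝ, F₂)) n (fun x ↦ TotalSpace.mk' F₂ x (v x)) x₀) :
    ContMDiffAt IB (IB.prod 𝓘(ℝ, F₁ →L[ℝ] F₂)) n
      (fun x ↦ TotalSpace.mk' (F₁ →L[ℝ] F₂) (E := fun x : B ↦ E₁ x →L[ℝ] E₂ x) x
        ((α x).smulRight (v x))) x₀ := by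
  rw [contMDiffAt_hom_bundle] at hα ⊢
  rw [contMDiffAt_totalSpace] at hv
  refine ⟨contMDiffAt_id, ((isBoundedBilinearMap_smulRight (𝕜 := ℝ) (E := F₁)
    (F := F₂)).contDiff.contMDiff.contMDiffAt.comp x₀
      (hα.2.prodMk_space hv.2)).congr_of_eventuallyEq ?_⟩
  filter_upwards [(trivializationAt F₂ E₂ x₀).open_baseSet.mem_nhds
    (FiberBundle.mem_baseSet_trivializationAt' x₀)] with y hy
  ext w
  simp [ContinuousLinearMap.inCoordinates, Trivialization.coe_linearMapAt_of_mem _ hy]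

theorem contMDiff_id_hom_bundle [ContMDiffVectorBundle n F₂ E₂ IB] :
    ContMDiff IB (IB.prod 𝓘(ℝ, F₂ →L[ℝ] F₂)) n
      (fun x ↦ TotalSpace.mk' (F₂ →L[ℝ] F₂) (E := fun x : B ↦ E₂ x →L[ℝ] E₂ x) x
        (ContinuousLinearMap.id ℝ (E₂ x))) := by
  intro x₀
  rw [contMDiffAt_hom_bundle]
  refine ⟨contMDiffAt_id,
    (contMDiffAt_const (c := ContinuousLinearMap.id ℝ F₂)).congr_of_eventuallyEq ?_⟩
  filter_upwards [(trivializationAt F₂ E₂ x₀).open_baseSet.mem_nhds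
    (FiberBundle.mem_baseSet_trivializationAt' x₀)] with y hy
  ext v
  simp [ContinuousLinearMap.inCoordinates, Trivialization.continuousLinearMapAt_symmL _ hy]

end Hom

set_option linter.unusedSectionVars false

section LeviCivita

variable {E : Type*} [NormedAddCommGroup E] [NormedSpace ℝ E] [FiniteDimensional ℝ E]
  {H : Type*} [TopologicalSpace H] {I : ModelWithCorners ℝ E H}
  {M : Type*} [TopologicalSpace M] [ChartedSpace H M] [IsManifold I ∞ M]
  [RiemannianBundle (fun x : M ↦ TangentSpace I x)]
  [IsContMDiffRiemannianBundle I ∞ E (fun x : M ↦ TangentSpace I x)]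
  {nabla : CovariantDerivative I E (TangentSpace I : M → Type _)}

/-- Vector fields which are differentiable at a point. -/
abbrev FieldDifferentiableAt (I : ModelWithCorners ℝ E H) {M : Type*} [TopologicalSpace M]
    [ChartedSpace H M] [IsManifold I ∞ M] (X : Π x : M, TangentSpace I x) (x : M) : Prop :=
  MDifferentiableAt I (I.prod 𝓘(ℝ, E))
    (fun y ↦ (⟨y, X y⟩ : TotalSpace E (TangentSpace I : M → Type _))) x

theorem IsSmoothField.fieldDifferentiableAt {X : Π x : M, TangentSpace I x}
    (hX : IsSmoothField I X) (x : M) : FieldDifferentiableAt I X x :=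
  (hX x).mdifferentiableAt (by simp)

theorem IsLeviCivita.mvfderiv_inner (hnabla : IsLeviCivita nabla)
    (X : Π x : M, TangentSpace I x) {Z W : Π x : M, TangentSpace I x} {x : M}
    (hZ : FieldDifferentiableAt I Z x) (hW : FieldDifferentiableAt I W x) :
    mvfderiv I (fun y ↦ (inner ℝ (Z y) (W y) : ℝ)) x (X x)
      = inner ℝ (nabla Z x (X x)) (W x) + inner ℝ (Z x) (nabla W x (X x)) :=
  hnabla.metric.mvfderiv_inner_eq X hZ hW

end LeviCivita

section Surface

variable {S : Type*} [TopologicalSpace S] [ChartedSpace (EuclideanSpace ℝ (Fin 2)) S]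
  [IsManifold (𝓡 2) ∞ S] [RiemannianBundle (fun x : S ↦ TangentSpace (𝓡 2) x)]
  [IsContMDiffRiemannianBundle (𝓡 2) ∞ (EuclideanSpace ℝ (Fin 2))
    (fun x : S ↦ TangentSpace (𝓡 2) x)]
  {o : Π x : S, Orientation ℝ (TangentSpace (𝓡 2) x) (Fin 2)}

theorem rot_apply (θ : ℝ) (x : S) (X : TangentSpace (𝓡 2) x) :
    rot o θ x X = Real.cos θ • X + Real.sin θ • (o x).rightAngleRotation X := rfl

theorem rot_comp_rot_neg (θ : ℝ) (x : S) (X : TangentSpace (𝓡 2) x) :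
    rot o θ x (rot o (-θ) x X) = X := by
  simp only [rot_apply, map_add, map_smul, Real.cos_neg, Real.sin_neg,
    Orientation.rightAngleRotation_rightAngleRotation]
  calc _ = (Real.cos θ ^ 2 + Real.sin θ ^ 2) • X := by module
    _ = X := by rw [Real.cos_sq_add_sin_sq, one_smul]

theorem rot_neg_comp_rot (θ : ℝ) (x : S) (X : TangentSpace (𝓡 2) x) :
    rot o (-θ) x (rot o θ x X) = X := by
  simpa using rot_comp_rot_neg (o := o) (-θ) x X

theorem inverse_rot (θ : ℝ) (x : S) : (rot o θ x).inverse = rot o (-θ) x :=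
  ContinuousLinearMap.inverse_eq (by ext1; simp [rot_comp_rot_neg])
    (by ext1; simp [rot_neg_comp_rot])

theorem inner_rot_left (θ : ℝ) (x : S) (X Y : TangentSpace (𝓡 2) x) :
    inner ℝ (rot o θ x X) Y = (inner ℝ X (rot o (-θ) x Y) : ℝ) := by
  simp only [rot_apply, inner_add_left, inner_add_right, inner_smul_left, inner_smul_right,
    Real.cos_neg, Real.sin_neg, (o x).inner_rightAngleRotation_left,
    (o x).inner_rightAngleRotation_right]
  simp

/-- The rotation by `π/2` of an oriented Riemannian surface is a smooth tensor field. -/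
theorem IsOrientation.contMDiff_rightAngleRotation (ho : IsOrientation o) :
    ContMDiff (𝓡 2) ((𝓡 2).prod 𝓘(ℝ, EuclideanSpace ℝ (Fin 2) →L[ℝ] EuclideanSpace ℝ (Fin 2))) ∞
      (fun x ↦ TotalSpace.mk' (EuclideanSpace ℝ (Fin 2) →L[ℝ] EuclideanSpace ℝ (Fin 2))
        (E := fun x : S ↦ TangentSpace (𝓡 2) x →L[ℝ] TangentSpace (𝓡 2) x) x
        ((o x).rightAngleRotation : TangentSpace (𝓡 2) x →L[ℝ] TangentSpace (𝓡 2) x)) := by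
  intro x
  obtain ⟨X, Y, hX, hY, hpos⟩ := ho x
  obtain ⟨g, hg, hg'⟩ := IsContMDiffRiemannianBundle.exists_contMDiff (IB := 𝓡 2) (n := ∞)
    (F := EuclideanSpace ℝ (Fin 2)) (E := fun x : S ↦ TangentSpace (𝓡 2) x)
  have hgX := (hg x).clm_bundle_apply hX
  have hgY := (hg x).clm_bundle_apply hY
  have hXX := hX.inner_bundle hX
  have hXY := hX.inner_bundle hY
  have hYY := hY.inner_bundle hY
  have hω : ContMDiffAt (𝓡 2) 𝓘(ℝ) ∞ (fun y ↦ (o y).areaForm (X y) (Y y)) x := by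
    have h0 : inner ℝ (X x) (X x) * inner ℝ (Y x) (Y x) - (inner ℝ (X x) (Y x) : ℝ) ^ 2 ≠ 0 := by
      rw [← areaForm_sq (o x)]
      exact (pow_pos hpos.self_of_nhds 2).ne'
    refine (((Real.contDiffAt_sqrt h0).contMDiffAt).comp x
      ((hXX.mul hYY).sub (hXY.pow 2))).congr_of_eventuallyEq ?_
    filter_upwards [hpos] with y hy
    simp only [Function.comp_apply, Pi.mul_apply]
    rw [← areaForm_sq (o y), Real.sqrt_sq hy.le]
  have hω' := hω.inv₀ hpos.self_of_nhds.ne'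
  have key := hω'.smul_section ((contMDiffAt_smulRight hgX hY).sub_section
    (contMDiffAt_smulRight hgY hX))
  refine key.congr_of_eventuallyEq ?_
  filter_upwards [hpos] with y hy
  congr 1
  ext1 Z
  have h := areaForm_smul_rightAngleRotation (o y) (X y) (Y y) Z
  rw [hg', hg'] at h
  exact (eq_inv_smul_iff₀ hy.ne').2 h

theorem IsOrientation.contMDiff_rot (ho : IsOrientation o) (θ : ℝ) :
    ContMDiff (𝓡 2) ((𝓡 2).prod 𝓘(ℝ, EuclideanSpace ℝ (Fin 2) →L[ℝ] EuclideanSpace ℝ (Fin 2))) ∞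
      (fun x ↦ TotalSpace.mk' (EuclideanSpace ℝ (Fin 2) →L[ℝ] EuclideanSpace ℝ (Fin 2))
        (E := fun x : S ↦ TangentSpace (𝓡 2) x →L[ℝ] TangentSpace (𝓡 2) x) x
        (rot o θ x)) :=
  (ContMDiff.const_smul_section contMDiff_id_hom_bundle).add_section
    (ContMDiff.const_smul_section ho.contMDiff_rightAngleRotation)

variable {nabla : CovariantDerivative (𝓡 2) (EuclideanSpace ℝ (Fin 2))
  (TangentSpace (𝓡 2) : S → Type _)} {Z W : Π x : S, TangentSpace (𝓡 2) x} {x : S}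

theorem IsOrientation.fieldDifferentiableAt_rightAngleRotation (ho : IsOrientation o)
    (hZ : FieldDifferentiableAt (𝓡 2) Z x) :
    FieldDifferentiableAt (𝓡 2) (fun y ↦ (o y).rightAngleRotation (Z y)) x :=
  ((ho.contMDiff_rightAngleRotation x).mdifferentiableAt (by simp)).clm_bundle_apply hZ

/-- The covariant derivative `∇_X J` of the rotation by `π/2`, applied to the field `Z`. -/
def nablaRotation (o : Π x : S, Orientation ℝ (TangentSpace (𝓡 2) x) (Fin 2))
    (nabla : CovariantDerivative (𝓡 2) (EuclideanSpace ℝ (Fin 2))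
      (TangentSpace (𝓡 2) : S → Type _))
    (X Z : Π x : S, TangentSpace (𝓡 2) x) (x : S) : TangentSpace (𝓡 2) x :=
  nabla (fun y ↦ (o y).rightAngleRotation (Z y)) x (X x)
    - (o x).rightAngleRotation (nabla Z x (X x))

theorem inner_nablaRotation (ho : IsOrientation o) (hnabla : IsLeviCivita nabla)
    (X : Π x : S, TangentSpace (𝓡 2) x)
    (hZ : FieldDifferentiableAt (𝓡 2) Z x) (hW : FieldDifferentiableAt (𝓡 2) W x) :
    (inner ℝ (nablaRotation o nabla X Z x) (W x) : ℝ)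
      = - inner ℝ (Z x) (nablaRotation o nabla X W x) := by
  have h1 := hnabla.mvfderiv_inner X (ho.fieldDifferentiableAt_rightAngleRotation hZ) hW
  have h2 := hnabla.mvfderiv_inner X hZ (ho.fieldDifferentiableAt_rightAngleRotation hW)
  have h3 : (fun y ↦ (inner ℝ (Z y) ((o y).rightAngleRotation (W y)) : ℝ))
      = -(fun y ↦ (inner ℝ ((o y).rightAngleRotation (Z y)) (W y) : ℝ)) := by
    funext y
    exact (o y).inner_rightAngleRotation_swap _ _
  have h4 : mvfderiv (𝓡 2) (fun y ↦ (inner ℝ (Z y) ((o y).rightAngleRotation (W y)) : ℝ)) x (X x)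
      = - mvfderiv (𝓡 2) (fun y ↦ (inner ℝ ((o y).rightAngleRotation (Z y)) (W y) : ℝ)) x (X x) := by
    have h5 := mvfderiv_neg (I := 𝓡 2) (x := x)
      (g := fun y ↦ (inner ℝ ((o y).rightAngleRotation (Z y)) (W y) : ℝ))
    rw [h3]
    exact congr($h5 (X x))
  rw [h1, h2] at h4
  simp only [nablaRotation, inner_sub_left, inner_sub_right]
  rw [(o x).inner_rightAngleRotation_swap'] at h4 ⊢
  rw [(o x).inner_rightAngleRotation_swap (Z x)]
  linarith [(o x).inner_rightAngleRotation_swap (nabla Z x (X x)) (W x),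
    (o x).inner_rightAngleRotation_swap (Z x) (nabla W x (X x))]

theorem nablaRotation_rightAngleRotation
    (X : Π x : S, TangentSpace (𝓡 2) x) (hZ : FieldDifferentiableAt (𝓡 2) Z x) :
    nablaRotation o nabla X (fun y ↦ (o y).rightAngleRotation (Z y)) x
      = - (o x).rightAngleRotation (nablaRotation o nabla X Z x) := by
  have h : nabla ((-1 : ℝ) • Z) x = (-1 : ℝ) • nabla Z x :=
    nabla.isCovariantDerivativeOn.smul_const _ hZ
  have h' : ((-1 : ℝ) • Z) = fun y ↦ - Z y := by ext1; simp
  rw [h'] at h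
  simp [nablaRotation, h, sub_eq_add_neg]

theorem nablaRotation_add (ho : IsOrientation o)
    (X : Π x : S, TangentSpace (𝓡 2) x) (hZ : FieldDifferentiableAt (𝓡 2) Z x)
    (hW : FieldDifferentiableAt (𝓡 2) W x) :
    nablaRotation o nabla X (Z + W) x
      = nablaRotation o nabla X Z x + nablaRotation o nabla X W x := by
  have h1 := nabla.isCovariantDerivativeOn.add hZ hW
  have h2 := nabla.isCovariantDerivativeOn.add (ho.fieldDifferentiableAt_rightAngleRotation hZ)
    (ho.fieldDifferentiableAt_rightAngleRotation hW)
  have h3 : (fun y ↦ (o y).rightAngleRotation ((Z + W) y))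
    = (fun y ↦ (o y).rightAngleRotation (Z y)) + fun y ↦ (o y).rightAngleRotation (W y) := by
    ext1; simp
  simp only [nablaRotation]
  rw [h3, h2, h1]
  simp only [_root_.add_apply, map_add]
  abel

theorem nablaRotation_eq_zero_of_ne_zero (ho : IsOrientation o) (hnabla : IsLeviCivita nabla)
    (X : Π x : S, TangentSpace (𝓡 2) x) (hZ : FieldDifferentiableAt (𝓡 2) Z x) (h0 : Z x ≠ 0) :
    nablaRotation o nabla X Z x = 0 := by
  apply eq_of_inner_rightAngleRotation (o x) h0
  · have := inner_nablaRotation ho hnabla X hZ hZ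
    rw [real_inner_comm] at this
    rw [real_inner_comm, inner_zero_left]
    linarith
  · have := inner_nablaRotation ho hnabla X hZ (ho.fieldDifferentiableAt_rightAngleRotation hZ)
    rw [nablaRotation_rightAngleRotation X hZ, inner_neg_right,
      (o x).inner_rightAngleRotation_swap (Z x), real_inner_comm] at this
    rw [inner_zero_left, real_inner_comm]
    linarith

/-- The rotation by `π/2` is parallel. -/
theorem nablaRotation_eq_zero (ho : IsOrientation o) (hnabla : IsLeviCivita nabla)
    (X : Π x : S, TangentSpace (𝓡 2) x) (hZ : FieldDifferentiableAt (𝓡 2) Z x) :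
    nablaRotation o nabla X Z x = 0 := by
  by_cases h0 : Z x = 0
  · obtain ⟨W, _, hW, -, hpos⟩ := ho x
    have hW' : FieldDifferentiableAt (𝓡 2) W x := hW.mdifferentiableAt (by simp)
    have hW0 : W x ≠ 0 := fun h ↦ by simpa [h] using hpos.self_of_nhds
    have hsum := nablaRotation_eq_zero_of_ne_zero ho hnabla X
      (mdifferentiableAt_add_section hZ hW') (by simpa [h0] using hW0)
    rwa [nablaRotation_add ho X hZ hW', nablaRotation_eq_zero_of_ne_zero ho hnabla X hW' hW0,
      add_zero] at hsum
  · exact nablaRotation_eq_zero_of_ne_zero ho hnabla X hZ h0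

theorem nabla_rot (ho : IsOrientation o) (hnabla : IsLeviCivita nabla) (θ : ℝ)
    (X : Π x : S, TangentSpace (𝓡 2) x) (hZ : FieldDifferentiableAt (𝓡 2) Z x) :
    nabla (fun y ↦ rot o θ y (Z y)) x (X x) = rot o θ x (nabla Z x (X x)) := by
  have hJ := ho.fieldDifferentiableAt_rightAngleRotation hZ
  have h := nabla.isCovariantDerivativeOn.add
    (MDifferentiableAt.smul_const_section (a := Real.cos θ) hZ)
    (MDifferentiableAt.smul_const_section (a := Real.sin θ) hJ)
  have h1 := nabla.isCovariantDerivativeOn.smul_const (Real.cos θ) hZ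
  have h2 := nabla.isCovariantDerivativeOn.smul_const (Real.sin θ) hJ
  have h3 := sub_eq_zero.1 (nablaRotation_eq_zero ho hnabla X hZ)
  rw [h1, h2] at h
  calc _ = (Real.cos θ • nabla Z x
      + Real.sin θ • nabla (fun y ↦ (o y).rightAngleRotation (Z y)) x) (X x) := congr($h (X x))
    _ = _ := by
      rw [_root_.add_apply, _root_.smul_apply,
        _root_.smul_apply, h3, rot_apply]

theorem IsOrientation.isSmoothField_rot (ho : IsOrientation o) (θ : ℝ)
    (hZ : IsSmoothField (𝓡 2) Z) :
    IsSmoothField (𝓡 2) (fun y ↦ rot o θ y (Z y)) :=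
  (ho.contMDiff_rot θ).clm_bundle_apply hZ

end Surface

section Dual

variable {E : Type*} [NormedAddCommGroup E] [NormedSpace ℝ E] [FiniteDimensional ℝ E]
  {H : Type*} [TopologicalSpace H] {I : ModelWithCorners ℝ E H}
  {M : Type*} [TopologicalSpace M] [ChartedSpace H M] [IsManifold I ∞ M]
  [RiemannianBundle (fun x : M ↦ TangentSpace I x)]
  [IsContMDiffRiemannianBundle I ∞ E (fun x : M ↦ TangentSpace I x)]
  {F : Type*} [NormedAddCommGroup F] [NormedSpace ℝ F] [FiniteDimensional ℝ F]
  {V : M → Type*} [TopologicalSpace (TotalSpace F V)]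
  [∀ x, NormedAddCommGroup (V x)] [∀ x, InnerProductSpace ℝ (V x)]
  [FiberBundle F V] [VectorBundle ℝ F V] [ContMDiffVectorBundle ∞ F V I]
  {m : ℕ} (D : TensorData I V m)

theorem TensorData.inner_A (x : M) (ξ : V x) (X Y : TangentSpace I x) :
    inner ℝ (D.A F x ξ X) Y = (inner ℝ (D.B x X Y) ξ : ℝ) :=
  haveI : FiniteDimensional ℝ (TangentSpace I x) :=
    VectorBundle.finiteDimensional ℝ E (TangentSpace I : M → Type _) x
  haveI : FiniteDimensional ℝ (V x) := VectorBundle.finiteDimensional ℝ F V x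
  haveI : CompleteSpace (TangentSpace I x) := FiniteDimensional.complete ℝ _
  haveI : CompleteSpace (V x) := FiniteDimensional.complete ℝ _
  inner_shapeOperator (D.B x) ξ X Y

theorem TensorData.inner_s (i : Fin m) (x : M) (ξ : V x) (X : TangentSpace I x) :
    inner ℝ (D.s F i x ξ) X = (inner ℝ ξ (D.h i x X) : ℝ) :=
  haveI : FiniteDimensional ℝ (TangentSpace I x) :=
    VectorBundle.finiteDimensional ℝ E (TangentSpace I : M → Type _) x
  haveI : FiniteDimensional ℝ (V x) := VectorBundle.finiteDimensional ℝ F V x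
  haveI : CompleteSpace (TangentSpace I x) := FiniteDimensional.complete ℝ _
  haveI : CompleteSpace (V x) := FiniteDimensional.complete ℝ _
  ContinuousLinearMap.adjoint_inner_left (D.h i x) X ξ

end Dual

section Rotate

variable {S : Type*} [TopologicalSpace S] [ChartedSpace (EuclideanSpace ℝ (Fin 2)) S]
  [IsManifold (𝓡 2) ∞ S] [RiemannianBundle (fun x : S ↦ TangentSpace (𝓡 2) x)]
  [IsContMDiffRiemannianBundle (𝓡 2) ∞ (EuclideanSpace ℝ (Fin 2))
    (fun x : S ↦ TangentSpace (𝓡 2) x)]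
  {o : Π x : S, Orientation ℝ (TangentSpace (𝓡 2) x) (Fin 2)}
  {F : Type*} [NormedAddCommGroup F] [NormedSpace ℝ F] [FiniteDimensional ℝ F]
  {V : S → Type*} [TopologicalSpace (TotalSpace F V)]
  [∀ x, NormedAddCommGroup (V x)] [∀ x, InnerProductSpace ℝ (V x)]
  [FiberBundle F V] [VectorBundle ℝ F V] [ContMDiffVectorBundle ∞ F V (𝓡 2)]
  {m : ℕ} {D : TensorData (𝓡 2) V m} {θ : ℝ} {x : S} {i : Fin m}

namespace TensorData

theorem rotate_B (X Y : TangentSpace (𝓡 2) x) :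
    (D.rotate o θ).B x X Y = D.B x (rot o (-θ) x X) Y := by
  simp only [rotate, inverse_rot, ContinuousLinearMap.comp_apply]

theorem rotate_f (X : TangentSpace (𝓡 2) x) :
    (D.rotate o θ).f i x X = rot o θ x (D.f i x (rot o (-θ) x X)) := by
  simp only [rotate, inverse_rot, ContinuousLinearMap.comp_apply]

theorem rotate_h (X : TangentSpace (𝓡 2) x) :
    (D.rotate o θ).h i x X = D.h i x (rot o (-θ) x X) := by
  simp only [rotate, inverse_rot, ContinuousLinearMap.comp_apply]

theorem rotate_t (ξ : V x) : (D.rotate o θ).t i x ξ = D.t i x ξ := rfl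

theorem rotate_s (ξ : V x) : (D.rotate o θ).s F i x ξ = rot o θ x (D.s F i x ξ) := by
  refine ext_inner_right ℝ fun X ↦ ?_
  rw [inner_s, rotate_h, inner_rot_left, inner_s]

theorem rotate_A (ξ : V x) (X : TangentSpace (𝓡 2) x) :
    (D.rotate o θ).A F x ξ X = D.A F x ξ (rot o (-θ) x X) := by
  refine ext_inner_right ℝ fun Y ↦ ?_
  rw [inner_A, inner_A, rotate_B]

theorem A_symm (hB : ∀ (x : S) (X Y : TangentSpace (𝓡 2) x), D.B x X Y = D.B x Y X)
    (ξ : V x) (X Y : TangentSpace (𝓡 2) x) :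
    inner ℝ (D.A F x ξ X) Y = (inner ℝ X (D.A F x ξ Y) : ℝ) := by
  rw [inner_A, real_inner_comm, real_inner_comm _ X, inner_A, hB, real_inner_comm]

theorem A_rightAngleRotation (hB : ∀ (x : S) (X Y : TangentSpace (𝓡 2) x), D.B x X Y = D.B x Y X)
    (hD : D.IsTraceFree F) (ξ : V x) (X : TangentSpace (𝓡 2) x) :
    D.A F x ξ ((o x).rightAngleRotation X) = -(o x).rightAngleRotation (D.A F x ξ X) :=
  map_rightAngleRotation_of_trace_eq_zero (o x) _ (A_symm hB ξ) (hD x ξ) X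

theorem A_rot_neg (hB : ∀ (x : S) (X Y : TangentSpace (𝓡 2) x), D.B x X Y = D.B x Y X)
    (hD : D.IsTraceFree F) (ξ : V x) (X : TangentSpace (𝓡 2) x) :
    D.A F x ξ (rot o (-θ) x X) = rot o θ x (D.A F x ξ X) := by
  simp only [rot_apply, map_add, map_smul, A_rightAngleRotation hB hD, Real.cos_neg, Real.sin_neg]
  module

theorem B_rot (hB : ∀ (x : S) (X Y : TangentSpace (𝓡 2) x), D.B x X Y = D.B x Y X)
    (hD : D.IsTraceFree F) (X Y : TangentSpace (𝓡 2) x) :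
    D.B x (rot o θ x X) Y = D.B x X (rot o θ x Y) := by
  refine ext_inner_right ℝ fun ξ ↦ ?_
  rw [← inner_A (F := F), ← inner_A (F := F)]
  have h := A_rot_neg (o := o) (θ := -θ) hB hD ξ X
  rw [neg_neg] at h
  rw [h, inner_rot_left, neg_neg]

theorem rotate_isTraceFree
    (hB : ∀ (x : S) (X Y : TangentSpace (𝓡 2) x), D.B x X Y = D.B x Y X)
    (hD : D.IsTraceFree F) : (D.rotate o θ).IsTraceFree F := by
  intro x ξ
  let j : TangentSpace (𝓡 2) x →ₗ[ℝ] TangentSpace (𝓡 2) x :=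
    (o x).rightAngleRotation.toLinearEquiv.toLinearMap
  have hj : D.A F x ξ * j = -(j * D.A F x ξ) :=
    LinearMap.ext fun X ↦ A_rightAngleRotation hB hD ξ X
  have h0 : LinearMap.trace ℝ _ (D.A F x ξ * j) = 0 := by
    have := congr(LinearMap.trace ℝ _ $hj)
    rw [map_neg, LinearMap.trace_mul_comm ℝ j] at this
    linarith
  have h : (D.rotate o θ).A F x ξ
      = Real.cos (-θ) • D.A F x ξ + Real.sin (-θ) • (D.A F x ξ * j) := by
    refine LinearMap.ext fun X ↦ ?_
    rw [rotate_A, rot_apply, map_add, map_smul, map_smul]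
    rfl
  rw [h, map_add, map_smul, map_smul, h0, hD x ξ]
  simp

theorem finrank_range_rotate_proj (i : Fin m) (x : S) :
    Module.finrank ℝ (LinearMap.range ((D.rotate o θ).proj F i x))
      = Module.finrank ℝ (LinearMap.range (D.proj F i x)) := by
  let e : TangentSpace (𝓡 2) x ≃ₗ[ℝ] TangentSpace (𝓡 2) x :=
    LinearEquiv.ofLinearMap (rot o θ x : TangentSpace (𝓡 2) x →ₗ[ℝ] TangentSpace (𝓡 2) x)
      (rot o (-θ) x : TangentSpace (𝓡 2) x →ₗ[ℝ] TangentSpace (𝓡 2) x)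
      (LinearMap.ext (rot_comp_rot_neg θ x)) (LinearMap.ext (rot_neg_comp_rot θ x))
  let e' := e.prodCongr (LinearEquiv.refl ℝ (V x))
  have h : (D.rotate o θ).proj F i x
      = e'.toLinearMap ∘ₗ D.proj F i x ∘ₗ e'.symm.toLinearMap := by
    refine LinearMap.ext fun ⟨X, ξ⟩ ↦ ?_
    refine Prod.ext ?_ ?_
    · change (D.rotate o θ).f i x X + (D.rotate o θ).s F i x ξ
        = rot o θ x (D.f i x (rot o (-θ) x X) + D.s F i x ξ)
      rw [rotate_f, rotate_s, map_add]
    · change (D.rotate o θ).h i x X + D.t i x ξ = D.h i x (rot o (-θ) x X) + D.t i x ξ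
      rw [rotate_h]
  rw [h, LinearMap.range_comp, LinearMap.range_comp_of_range_eq_top _ e'.symm.range,
    LinearEquiv.finrank_map_eq]

theorem IsSmooth.rotate (ho : IsOrientation o) (hD : D.IsSmooth F) :
    (D.rotate o θ).IsSmooth F where
  B x := by
    simp only [TensorData.rotate, inverse_rot]
    exact contMDiffAt_clm_bundle_comp (hD.B x) (ho.contMDiff_rot _ x)
  f i x := by
    simp only [TensorData.rotate, inverse_rot]
    exact contMDiffAt_clm_bundle_comp (ho.contMDiff_rot _ x)
      (contMDiffAt_clm_bundle_comp (hD.f i x) (ho.contMDiff_rot _ x))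
  h i x := by
    simp only [TensorData.rotate, inverse_rot]
    exact contMDiffAt_clm_bundle_comp (hD.h i x) (ho.contMDiff_rot _ x)
  t := hD.t

end TensorData

theorem antisymm_rot {G : Type*} [AddCommGroup G] [Module ℝ G] (θ : ℝ)
    (b : TangentSpace (𝓡 2) x →ₗ[ℝ] TangentSpace (𝓡 2) x →ₗ[ℝ] G) (X Y : TangentSpace (𝓡 2) x) :
    b (rot o θ x X) (rot o θ x Y) - b (rot o θ x Y) (rot o θ x X) = b X Y - b Y X :=
  antisymm_comp_rotation (o x) b θ (rot_apply θ x) X Y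

/-- Invariance under rotations of `⟨T Y, Z⟩ L X - ⟨T X, Z⟩ L Y` in the pair `X`, `Y`. -/
theorem inner_smul_sub_rot {G : Type*} [AddCommGroup G] [Module ℝ G]
    {U : Type*} [NormedAddCommGroup U] [InnerProductSpace ℝ U] (θ : ℝ)
    (T : TangentSpace (𝓡 2) x →ₗ[ℝ] U) (L : TangentSpace (𝓡 2) x →ₗ[ℝ] G)
    (Z : U) (X Y : TangentSpace (𝓡 2) x) :
    (inner ℝ (T (rot o θ x Y)) Z : ℝ) • L (rot o θ x X)
        - (inner ℝ (T (rot o θ x X)) Z : ℝ) • L (rot o θ x Y)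
      = (inner ℝ (T Y) Z : ℝ) • L X - (inner ℝ (T X) Z : ℝ) • L Y :=
  antisymm_rot θ (LinearMap.mk₂ ℝ (fun X Y ↦ (inner ℝ (T Y) Z : ℝ) • L X)
    (fun _ _ _ ↦ by simp) (fun _ _ _ ↦ by rw [map_smul, smul_comm])
    (fun _ _ _ ↦ by simp [inner_add_left, add_smul])
    (fun _ _ _ ↦ by simp [inner_smul_left, mul_smul])) X Y

end Rotate

section Equations

variable {S : Type*} [TopologicalSpace S] [ChartedSpace (EuclideanSpace ℝ (Fin 2)) S]
  [IsManifold (𝓡 2) ∞ S] [RiemannianBundle (fun x : S ↦ TangentSpace (𝓡 2) x)]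
  [IsContMDiffRiemannianBundle (𝓡 2) ∞ (EuclideanSpace ℝ (Fin 2))
    (fun x : S ↦ TangentSpace (𝓡 2) x)]
  {o : Π x : S, Orientation ℝ (TangentSpace (𝓡 2) x) (Fin 2)}
  {F : Type*} [NormedAddCommGroup F] [NormedSpace ℝ F] [FiniteDimensional ℝ F]
  {V : S → Type*} [TopologicalSpace (TotalSpace F V)]
  [∀ x, NormedAddCommGroup (V x)] [∀ x, InnerProductSpace ℝ (V x)]
  [FiberBundle F V] [VectorBundle ℝ F V] [ContMDiffVectorBundle ∞ F V (𝓡 2)]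
  {m : ℕ} {D : TensorData (𝓡 2) V m} {θ : ℝ}

/-- The curvature term of the Gauss equation is invariant under rotations. -/
theorem inner_smul_sub_rot_conj {x : S} (T : TangentSpace (𝓡 2) x →ₗ[ℝ] TangentSpace (𝓡 2) x)
    (θ : ℝ) (X Y Z : TangentSpace (𝓡 2) x) :
    (inner ℝ (rot o θ x (T (rot o (-θ) x Y))) Z : ℝ) • rot o θ x (T (rot o (-θ) x X))
        - (inner ℝ (rot o θ x (T (rot o (-θ) x X))) Z : ℝ) • rot o θ x (T (rot o (-θ) x Y))
      = (inner ℝ (T Y) Z : ℝ) • T X - (inner ℝ (T X) Z : ℝ) • T Y := by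
  rw [inner_rot_left, inner_rot_left, ← map_smul (rot o θ x), ← map_smul (rot o θ x),
    ← map_sub (rot o θ x)]
  rw [inner_smul_sub_rot (-θ) T T]
  refine ext_inner_right ℝ fun W ↦ ?_
  rw [inner_rot_left]
  have h := antisymm_rot (o := o) (-θ) (LinearMap.mk₂ ℝ
    (fun Z W ↦ (inner ℝ (T Y) Z * inner ℝ (T X) W : ℝ))
    (fun _ _ _ ↦ by simp only [inner_add_right]; ring)
    (fun _ _ _ ↦ by simp only [inner_smul_right, smul_eq_mul]; ring)
    (fun _ _ _ ↦ by simp only [inner_add_right]; ring)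
    (fun _ _ _ ↦ by simp only [inner_smul_right, smul_eq_mul]; ring)) Z W
  simp only [LinearMap.mk₂_apply] at h
  simp only [inner_sub_left, inner_smul_left, conj_trivial]
  linarith

theorem TensorData.A_B_sub_rot {x : S} (X Y Z : TangentSpace (𝓡 2) x) :
    D.A F x (D.B x (rot o θ x Y) Z) (rot o θ x X) - D.A F x (D.B x (rot o θ x X) Z) (rot o θ x Y)
      = D.A F x (D.B x Y Z) X - D.A F x (D.B x X Z) Y := by
  refine ext_inner_right ℝ fun W ↦ ?_
  simp only [inner_sub_left, inner_A]
  exact antisymm_rot θ (LinearMap.mk₂ ℝ (fun X Y ↦ (inner ℝ (D.B x X W) (D.B x Y Z) : ℝ))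
    (fun _ _ _ ↦ by rw [(D.B x).map_add, _root_.add_apply, inner_add_left])
    (fun _ _ _ ↦ by
      rw [(D.B x).map_smul, _root_.smul_apply, real_inner_smul_left, smul_eq_mul])
    (fun _ _ _ ↦ by rw [(D.B x).map_add, _root_.add_apply, inner_add_right])
    (fun _ _ _ ↦ by
      rw [(D.B x).map_smul, _root_.smul_apply, real_inner_smul_right, smul_eq_mul])) X Y

variable {nabla : CovariantDerivative (𝓡 2) (EuclideanSpace ℝ (Fin 2))
    (TangentSpace (𝓡 2) : S → Type _)} {nablaBar : CovariantDerivative (𝓡 2) F V}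
  {n : Fin m → ℕ} {c : Fin m → ℝ}

open TensorData in
theorem Compatible.rotate (ho : IsOrientation o) (hnabla : IsLeviCivita nabla)
    (hD : Compatible nabla nablaBar n c D) (hB : D.IsTraceFree F) :
    Compatible nabla nablaBar n c (D.rotate o θ) where
  smooth := hD.smooth.rotate ho
  symm_B x X Y := by rw [rotate_B, rotate_B, B_rot hD.symm_B hB, hD.symm_B]
  symm_f i x X Y := by
    have h := inner_rot_left (o := o) (-θ) x X (D.f i x (rot o (-θ) x Y))
    rw [neg_neg] at h
    rw [rotate_f, rotate_f, inner_rot_left, hD.symm_f, h]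
  symm_t := hD.symm_t
  sum_f x X := by
    simp only [rotate_f, ← map_sum, hD.sum_f, rot_comp_rot_neg]
  sum_t := hD.sum_t
  sum_s x ξ := by simp only [rotate_s, ← map_sum, hD.sum_s, map_zero]
  sum_h x X := by simp only [rotate_h, hD.sum_h]
  ff_sh i j x X := by
    rw [rotate_f, rotate_f, rotate_s, rotate_h, rot_neg_comp_rot, ← map_add, hD.ff_sh]
    split_ifs
    · exact (rotate_f X).symm
    · exact map_zero _
  tt_hs i j x ξ := by
    simp only [rotate_t, rotate_h, rotate_s, rot_neg_comp_rot, hD.tt_hs]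
  fs_st i j x ξ := by
    rw [rotate_f, rotate_s, rotate_s, rotate_s, rotate_t, rot_neg_comp_rot, ← map_add, hD.fs_st]
    split_ifs
    · exact rfl
    · exact map_zero _
  hf_th i j x X := by
    simp only [rotate_t, rotate_h, rotate_f, rot_neg_comp_rot, hD.hf_th]
  deriv_f i X Y hX hY x := by
    have hY' := ho.isSmoothField_rot (-θ) hY
    have hfY : IsSmoothField (𝓡 2) (fun y ↦ D.f i y (rot o (-θ) y (Y y))) :=
      (hD.smooth.f i).clm_bundle_apply hY'
    have h := hD.deriv_f i X _ hX hY' x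
    rw [nabla_rot ho hnabla _ X (hY.fieldDifferentiableAt x)] at h
    simp only [rotate_f, rotate_h, rotate_s, rotate_A, rotate_B]
    rw [nabla_rot ho hnabla θ X (hfY.fieldDifferentiableAt x), ← map_sub, h, map_add,
      A_rot_neg hD.symm_B hB, B_rot hD.symm_B hB]
  deriv_h i X Y hX hY x := by
    have h := hD.deriv_h i X _ hX (ho.isSmoothField_rot (-θ) hY) x
    rw [nabla_rot ho hnabla _ X (hY.fieldDifferentiableAt x)] at h
    simp only [rotate_f, rotate_h, rotate_t, rotate_B]
    rw [h, B_rot hD.symm_B hB, B_rot hD.symm_B hB, rot_neg_comp_rot]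
  deriv_t i X ξ hX hξ x := by
    simp only [rotate_h, rotate_t, rotate_B, rotate_A, rotate_s]
    rw [hD.deriv_t i X ξ hX hξ x, A_rot_neg hD.symm_B hB, rot_neg_comp_rot, rot_neg_comp_rot]
  rank_proj i x := by rw [finrank_range_rotate_proj, hD.rank_proj]
  sum_dim := hD.sum_dim
  gauss X Y Z hX hY hZ x := by
    rw [hD.gauss X Y Z hX hY hZ x, add_sub_assoc, add_sub_assoc]
    simp only [rotate_A, rotate_B, rotate_f]
    rw [A_B_sub_rot]
    congr 1
    exact Finset.sum_congr rfl fun i _ ↦ congr(c i • $((inner_smul_sub_rot_conj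
      (D.f i x : TangentSpace (𝓡 2) x →ₗ[ℝ] TangentSpace (𝓡 2) x) θ (X x) (Y x) (Z x)).symm))
  codazzi X Y Z hX hY hZ x := by
    have hcov (X Y : Π x : S, TangentSpace (𝓡 2) x) :
        covDerivB nabla nablaBar (D.rotate o θ).B X Y Z x
          = covDerivB nabla nablaBar D.B X Y (fun y ↦ rot o (-θ) y (Z y)) x := by
      simp only [covDerivB, rotate_B, B_rot hD.symm_B hB]
      rw [nabla_rot ho hnabla _ X (hZ.fieldDifferentiableAt x)]
    rw [hcov, hcov, hD.codazzi X Y _ hX hY (ho.isSmoothField_rot (-θ) hZ) x]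
    simp only [rotate_f, rotate_h, inner_rot_left]
    exact Finset.sum_congr rfl fun i _ ↦ congr(c i • $((inner_smul_sub_rot (-θ)
      (D.f i x : TangentSpace (𝓡 2) x →ₗ[ℝ] TangentSpace (𝓡 2) x)
      (D.h i x : TangentSpace (𝓡 2) x →ₗ[ℝ] V x) (rot o (-θ) x (Z x)) (X x) (Y x)).symm))
  ricci X Y ξ hX hY hξ x := by
    rw [hD.ricci X Y ξ hX hY hξ x]
    simp only [rotate_h, rotate_A, rotate_B, A_rot_neg hD.symm_B hB, rot_neg_comp_rot]
    congr 2
    exact Finset.sum_congr rfl fun i _ ↦ congr(c i • $((inner_smul_sub_rot (-θ)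
      (D.h i x : TangentSpace (𝓡 2) x →ₗ[ℝ] V x)
      (D.h i x : TangentSpace (𝓡 2) x →ₗ[ℝ] V x) (ξ x) (X x) (Y x)).symm))

end Equations

end Multiproduct

end

theorem mainTheorem2
    -- an oriented Riemannian surface with its Levi-Civita connection
    {S : Type*} [TopologicalSpace S] [T2Space S] [SigmaCompactSpace S]
    [ChartedSpace (EuclideanSpace ℝ (Fin 2)) S] [IsManifold (𝓡 2) ∞ S]
    [RiemannianBundle (fun x : S ↦ TangentSpace (𝓡 2) x)]
    [IsContMDiffRiemannianBundle (𝓡 2) ∞ (EuclideanSpace ℝ (Fin 2))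
      (fun x : S ↦ TangentSpace (𝓡 2) x)]
    (o : Π x : S, Orientation ℝ (TangentSpace (𝓡 2) x) (Fin 2))
    (ho : Multiproduct.IsOrientation o)
    (nabla : CovariantDerivative (𝓡 2) (EuclideanSpace ℝ (Fin 2))
      (TangentSpace (𝓡 2) : S → Type _))
    (hnabla : Multiproduct.IsLeviCivita nabla)
    -- a vector bundle with a metric and a compatible connection
    {F : Type*} [NormedAddCommGroup F] [NormedSpace ℝ F] [FiniteDimensional ℝ F]
    {V : S → Type*} [TopologicalSpace (TotalSpace F V)]
    [∀ x, NormedAddCommGroup (V x)] [∀ x, InnerProductSpace ℝ (V x)]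
    [FiberBundle F V] [VectorBundle ℝ F V] [ContMDiffVectorBundle ∞ F V (𝓡 2)]
    [IsContMDiffRiemannianBundle (𝓡 2) ∞ F V]
    (nablaBar : CovariantDerivative (𝓡 2) F V)
    [CovariantDerivative.ContMDiffCovariantDerivative nablaBar ∞]
    (hnablaBar : nablaBar.IsMetricCompatible)
    -- dimensions and curvatures of the factors, and the tensor fields
    {m : ℕ} (n : Fin m → ℕ) (c : Fin m → ℝ) (D : Multiproduct.TensorData (𝓡 2) V m)
    (hD : Multiproduct.Compatible nabla nablaBar n c D) (hB : D.IsTraceFree F) (θ : ℝ) :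
    Multiproduct.Compatible nabla nablaBar n c (D.rotate o θ) ∧ (D.rotate o θ).IsTraceFree F := by
  exact ⟨hD.rotate ho hnabla hB, Multiproduct.TensorData.rotate_isTraceFree hD.symm_B hB⟩
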